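/- For partitions $\mu\subseteq\lambda$, let $f^{\lambda/\mu}$ denote the number of standard Young tableaux of skew shape $\lambda/\mu$, i.e. the number of bijective fillings of the boxes of $\lambda/\mu$ with $1,2,\ldots,|\lambda/\mu|$ that increase along every row (left to right) and down every column. For $n\ge 1$ define the skew shapes $$\sigma_{3n-2}=(n,n,n-1,n-2,\ldots,3,2)/(n-2,n-3,\ldots,1,0),$$ $$\sigma_{3n-1}=(n,n,n,n-1,n-2,\ldots,3,2)/(n-1,n-2,\ldots,1,0),$$ $$\tau_{3n}=(n+1,n+1,n+1,n,n-1,\ldots,4,3)/(n,n-1,\ldots,1,0),$$ with $3n-2$, $3n-1$ and $3n$ boxes and with $n$, $n+1$ and $n+1$ rows, respectively; for small $n$ this means $\sigma_1=(1)$, $\sigma_4=(2,2)$, $\sigma_2=(1,1)$, $\sigma_5=(2,2,2)/(1)$, $\tau_3=(2,2)/(1)$, $\tau_6=(3,3,3)/(2,1)$. Then for every $n\ge 2$, $$f^{\sigma_{3n-2}}=\frac{1}{2n-1}\sum_{i=1}^{n-1}\binom{3n-2}{3i-1}f^{\sigma_{3i-1}}f^{\sigma_{3n-3i-1}},$$ $$f^{\tau_{3n}}=\frac{1}{2n+1}\sum_{i=1}^{n-1}\binom{3n}{3i}f^{\tau_{3i}}f^{\tau_{3n-3i}}.$$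 -/

import Mathlib

/-- A skew shape `λ/μ`: two Young diagrams with `μ` contained in `λ`. -/
structure SkewShape where
  outer : YoungDiagram
  inner : YoungDiagram
  inner_le : inner ≤ outer

/-- The boxes `(row, column)` of the skew diagram `λ/μ`. Rows are numbered from top to bottom and
columns from left to right, both from `0`. -/
def SkewShape.cells (S : SkewShape) : Finset (ℕ × ℕ) :=
  S.outer.cells \ S.inner.cells

/-- A standard Young tableau of skew shape `S`: a bijective filling of the boxes with
`1, 2, …, |S|` that increases along rows and columns. -/
structure StandardTableau (S : SkewShape) where
  entry : S.cells ≃ Finset.Icc 1 S.cells.card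
  row_lt : ∀ c d : S.cells, c.1.1 = d.1.1 → c.1.2 < d.1.2 → (entry c : ℕ) < (entry d : ℕ)
  col_lt : ∀ c d : S.cells, c.1.2 = d.1.2 → c.1.1 < d.1.1 → (entry c : ℕ) < (entry d : ℕ)

/-- `f^{λ/μ}`: the number of standard Young tableaux of shape `λ/μ`. -/
noncomputable def numTableaux (S : SkewShape) : ℕ :=
  Nat.card (StandardTableau S)

theorem entry_injective (S : SkewShape) :
    Function.Injective (StandardTableau.entry : StandardTableau S → _) := by
  rintro ⟨_, _, _⟩ ⟨_, _, _⟩ h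
  cases h
  rfl

/-- The count `numTableaux` is an honest one: there are finitely many tableaux. -/
instance (S : SkewShape) : Finite (StandardTableau S) :=
  Finite.of_injective _ (entry_injective S)

/-- The decreasing list `a + k - 1, …, a + 1, a` with `k` entries. -/
def descending (a k : ℕ) : List ℕ := (List.range' a k).reverse

theorem length_descending (a k : ℕ) : (descending a k).length = k := by
  simp [descending]

theorem getElem_descending (a k i : ℕ) (h : i < (descending a k).length) :
    (descending a k)[i] = a + (k - 1 - i) := by
  simp [descending]

theorem mem_descending {a k x : ℕ} : x ∈ descending a k ↔ a ≤ x ∧ x < a + k := by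
  simp [descending]

theorem sorted_descending (a k : ℕ) : (descending a k).SortedGE := by
  rw [List.sortedGE_iff_pairwise, descending, List.pairwise_reverse]
  exact (List.pairwise_lt_range' (s := a) (n := k)).imp fun h => le_of_lt h

theorem sorted_cons_descending (b a k : ℕ) (h : 0 < k → a + k ≤ b + 1) :
    (b :: descending a k).SortedGE := by
  rw [List.sortedGE_iff_pairwise, List.pairwise_cons]
  refine ⟨fun x hx => ?_, (sorted_descending a k).pairwise⟩
  have := mem_descending.1 hx
  omega

theorem sorted_cons_cons_descending (b a k : ℕ) (h : 0 < k → a + k ≤ b + 1) :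
    (b :: b :: descending a k).SortedGE := by
  rw [List.sortedGE_iff_pairwise, List.pairwise_cons]
  refine ⟨fun x hx => ?_, (sorted_cons_descending b a k h).pairwise⟩
  rcases List.mem_cons.1 hx with rfl | hx
  · exact le_rfl
  · have := mem_descending.1 hx
    omega

theorem ofRowLens_le {v w : List ℕ} (hv : v.SortedGE) (hw : w.SortedGE)
    (hlen : v.length ≤ w.length)
    (hle : ∀ (i : ℕ) (h₁ : i < v.length) (h₂ : i < w.length), v[i] ≤ w[i]) :
    YoungDiagram.ofRowLens v hv ≤ YoungDiagram.ofRowLens w hw := by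
  intro c hc
  obtain ⟨h₁, h₂⟩ := YoungDiagram.mem_ofRowLens.1 hc
  exact YoungDiagram.mem_ofRowLens.2
    ⟨h₁.trans_le hlen, h₂.trans_le (hle c.1 h₁ (h₁.trans_le hlen))⟩

/-- The shape `σ_{3n-2} = (n, n, n-1, …, 3, 2)/(n-2, n-3, …, 1, 0)`, for `n ≥ 1`.
It is `(1)` for `n = 1` and `(2, 2)` for `n = 2`. -/
def sigmaSubTwo (n : ℕ) : SkewShape where
  outer := YoungDiagram.ofRowLens (n :: descending 2 (n - 1))
    (sorted_cons_descending _ _ _ (by omega))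
  inner := YoungDiagram.ofRowLens (descending 0 (n - 1)) (sorted_descending _ _)
  inner_le := ofRowLens_le _ _ (by simp [length_descending]) (by
    rintro (_ | i) h₁ h₂ <;>
      simp only [List.length_cons, length_descending] at h₁ h₂ <;>
      simp only [List.getElem_cons_zero, List.getElem_cons_succ, getElem_descending] <;> omega)

/-- The shape `σ_{3n-1} = (n, n, n, n-1, …, 3, 2)/(n-1, n-2, …, 1, 0)`, for `n ≥ 1`.
It is `(1, 1)` for `n = 1` and `(2, 2, 2)/(1)` for `n = 2`. -/
def sigmaSubOne (n : ℕ) : SkewShape where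
  outer := YoungDiagram.ofRowLens (n :: n :: descending 2 (n - 1))
    (sorted_cons_cons_descending _ _ _ (by omega))
  inner := YoungDiagram.ofRowLens (descending 0 n) (sorted_descending _ _)
  inner_le := ofRowLens_le _ _ (by simp [length_descending]; omega) (by
    rintro (_ | _ | i) h₁ h₂ <;>
      simp only [List.length_cons, length_descending] at h₁ h₂ <;>
      simp only [List.getElem_cons_zero, List.getElem_cons_succ, getElem_descending] <;> omega)

/-- The shape `τ_{3n} = (n+1, n+1, n+1, n, …, 4, 3)/(n, n-1, …, 1, 0)`, for `n ≥ 1`.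
It is `(2, 2)/(1)` for `n = 1` and `(3, 3, 3)/(2, 1)` for `n = 2`. -/
def tauShape (n : ℕ) : SkewShape where
  outer := YoungDiagram.ofRowLens ((n + 1) :: (n + 1) :: descending 3 (n - 1))
    (sorted_cons_cons_descending _ _ _ (by omega))
  inner := YoungDiagram.ofRowLens (descending 0 (n + 1)) (sorted_descending _ _)
  inner_le := ofRowLens_le _ _ (by simp [length_descending]; omega) (by
    rintro (_ | _ | i) h₁ h₂ <;>
      simp only [List.length_cons, length_descending] at h₁ h₂ <;>
      simp only [List.getElem_cons_zero, List.getElem_cons_succ, getElem_descending] <;> omega)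

/-!
Up to the factor `N!`, the number of standard fillings of a shape with `N` boxes is the probability
that independent uniform variables on the boxes increase along rows and columns. The shapes here
consist of three antidiagonals; integrating out the two outer ones leaves an integral over the
middle one, whose consecutive boxes interact through `min x y * (1 - max x y)`. This is the Green
function of `-d²/dx²` on `[0, 1]`, so with `K` its integral operator and `r, c ∈ {0, 1}` the numbers
of extra boxes at the two ends, the probability is `⟨K ^ m (X ^ r), X ^ c⟩`.

The recurrence expresses that the Euler operator `E = x d/dx` has the rank-one commutator
`E K = K E + 2 K - ⟨X, ·⟩ X` with `K`: expanding `E K ^ (m + 1)` inserts a rank-one term at each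
place of the product, which cuts the shape into two shapes with an end box at the cut, and moving
`E` to the other side of the pairing by parts gives the factor on the left.
-/

open MeasureTheory

section LinearExtensions

variable {ι L α : Type*}

theorem ae_ne_pi [Fintype ι] [MeasurableSpace α] [MeasurableEq α] (μ : Measure α)
    [IsProbabilityMeasure μ] [NullSingletonClass μ] {i j : ι} (hij : i ≠ j) :
    ∀ᵐ x ∂Measure.pi (fun _ : ι => μ), x i ≠ x j := by
  have hdiag : ∀ᵐ p ∂μ.prod μ, p.1 ≠ p.2 :=
    (Measure.ae_prod_iff_ae_ae (measurableSet_eq_fun measurable_fst measurable_snd).compl).2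
      (.of_forall fun a => (Measure.ae_ne μ a).mono fun _ h => h.symm)
  have hindep : ProbabilityTheory.IndepFun (fun x : ι → α => x i) (fun x => x j)
      (Measure.pi fun _ => μ) :=
    (ProbabilityTheory.iIndepFun_pi (X := fun _ x => x) fun _ => aemeasurable_id).indepFun hij
  have hmap := (ProbabilityTheory.indepFun_iff_map_prod_eq_prod_map_map
    (measurable_pi_apply i).aemeasurable (measurable_pi_apply j).aemeasurable).1 hindep
  rw [(measurePreserving_eval (fun _ : ι => μ) i).map_eq,
    (measurePreserving_eval (fun _ : ι => μ) j).map_eq] at hmap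
  rw [← hmap] at hdiag
  exact ae_of_ae_map (p := fun p : α × α => p.1 ≠ p.2) (by fun_prop) hdiag

theorem ae_injective_pi [Fintype ι] [MeasurableSpace α] [MeasurableEq α] (μ : Measure α)
    [IsProbabilityMeasure μ] [NullSingletonClass μ] :
    ∀ᵐ x ∂Measure.pi (fun _ : ι => μ), Function.Injective x := by
  refine ae_all_iff.2 fun i => ae_all_iff.2 fun j => ?_
  by_cases hij : i = j
  · exact .of_forall fun _ _ => hij
  · exact (ae_ne_pi μ hij).mono fun x hx h => absurd h hx

/-- The points of `ι → α` whose coordinates are sorted in the order that the bijection `e`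
transports to `ι`: one of the chambers into which the diagonals `x i = x j` cut the space. -/
def orderChamber (α : Type*) [Preorder α] [Preorder L] (e : ι ≃ L) : Set (ι → α) :=
  {x | StrictMono (x ∘ e.symm)}

variable [LinearOrder L] [LinearOrder α]

theorem lt_iff_of_mem_orderChamber {e : ι ≃ L} {x : ι → α} (hx : x ∈ orderChamber α e) (i j : ι) :
    x i < x j ↔ e i < e j := by
  simpa using hx.lt_iff_lt (a := e i) (b := e j)

theorem exists_mem_orderChamber [Fintype ι] [Fintype L] (h : Fintype.card ι = Fintype.card L)
    {x : ι → α} (hx : Function.Injective x) : ∃ e : ι ≃ L, x ∈ orderChamber α e := by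
  let _ : LinearOrder ι := LinearOrder.lift' x hx
  let e : ι ≃o L := (Fintype.orderIsoFinOfCardEq ι h).symm.trans
    (Fintype.orderIsoFinOfCardEq L rfl)
  exact ⟨e.toEquiv, fun _ _ hab => e.symm.lt_iff_lt.2 hab⟩

theorem pairwise_disjoint_orderChamber [WellFoundedLT L] :
    Pairwise (Function.onFun Disjoint fun e : ι ≃ L => orderChamber α e) := by
  refine fun e e' hne => Set.disjoint_left.2 fun x (hx : StrictMono _) (hx' : StrictMono _) =>
    hne ?_
  have hinj : Function.Injective x := (e.symm.injective_comp x).1 hx.injective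
  have hcomp : x ∘ e.symm = x ∘ e'.symm := (hx.range_inj hx').1 (by simp)
  exact Equiv.symm_bijective.injective (Equiv.ext fun a => hinj (congrFun hcomp a))

variable [MeasurableSpace α]

theorem measure_orderChamber [Fintype ι] [Fintype L] (μ : Measure α) [SigmaFinite μ] (e : ι ≃ L) :
    Measure.pi (fun _ : ι => μ) (orderChamber α e) =
      Measure.pi (fun _ : L => μ) {y | StrictMono y} := by
  rw [← (measurePreserving_piCongrLeft (fun _ : L => μ) e).measure_preimage_equiv]
  congr 1
  ext x
  have : MeasurableEquiv.piCongrLeft (fun _ => α) e x = x ∘ e.symm := by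
    ext a
    obtain ⟨i, rfl⟩ := e.surjective a
    rw [MeasurableEquiv.piCongrLeft_apply_apply]
    simp
  simp [orderChamber, this]

variable [TopologicalSpace α] [OrderClosedTopology α] [SecondCountableTopology α]
  [OpensMeasurableSpace α]

theorem measurableSet_orderChamber [Countable L] (e : ι ≃ L) :
    MeasurableSet (orderChamber α e) := by
  simp only [orderChamber, StrictMono, Set.ofPred_forall]
  exact .iInter fun a => .iInter fun b => .iInter fun _ =>
    measurableSet_lt (measurable_pi_apply _) (measurable_pi_apply _)

variable [Fintype ι] [Fintype L] (μ : Measure α) [IsProbabilityMeasure μ] [NullSingletonClass μ]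

theorem pi_setOf_forall_lt (h : Fintype.card ι = Fintype.card L) (r : ι → ι → Prop) :
    Measure.pi (fun _ : ι => μ) {x | ∀ i j, r i j → x i < x j} =
      Nat.card {e : ι ≃ L // ∀ i j, r i j → e i < e j} *
        Measure.pi (fun _ : L => μ) {y | StrictMono y} := by
  have hunion : {x : ι → α | ∀ i j, r i j → x i < x j} =ᵐ[Measure.pi fun _ => μ]
      ⋃ e : {e : ι ≃ L // ∀ i j, r i j → e i < e j}, orderChamber α e.1 := by
    filter_upwards [ae_injective_pi μ] with x hx
    obtain ⟨e, he⟩ := exists_mem_orderChamber h hx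
    refine propext ⟨fun hr => Set.mem_iUnion.2 ⟨⟨e, fun i j hij => ?_⟩, he⟩, fun hx i j hij => ?_⟩
    · exact (lt_iff_of_mem_orderChamber he i j).1 (hr i j hij)
    · obtain ⟨e', he'⟩ := Set.mem_iUnion.1 hx
      exact (lt_iff_of_mem_orderChamber he' i j).2 (e'.2 i j hij)
  have hdisj : Pairwise (Function.onFun Disjoint
      fun e : {e : ι ≃ L // ∀ i j, r i j → e i < e j} => orderChamber α e.1) :=
    fun e e' hne => pairwise_disjoint_orderChamber (Subtype.val_injective.ne hne)
  rw [measure_congr hunion, measure_iUnion hdisj fun e => measurableSet_orderChamber e.1]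
  simp only [measure_orderChamber, ENNReal.tsum_const]
  rw [ENat.card_eq_coe_natCard]
  rfl

theorem factorial_mul_pi_strictMono (L : Type*) [Fintype L] [LinearOrder L] :
    (Fintype.card L).factorial * Measure.pi (fun _ : L => μ) {y | StrictMono y} = 1 := by
  classical
  have h := pi_setOf_forall_lt μ (rfl : Fintype.card L = _) fun _ _ => False
  simpa [Fintype.card_perm, Nat.card_eq_fintype_card] using h.symm

theorem card_linearExtensions (h : Fintype.card ι = Fintype.card L) (r : ι → ι → Prop) :
    (Nat.card {e : ι ≃ L // ∀ i j, r i j → e i < e j} : ENNReal) =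
      (Fintype.card ι).factorial *
        Measure.pi (fun _ : ι => μ) {x | ∀ i j, r i j → x i < x j} := by
  rw [pi_setOf_forall_lt μ h, mul_left_comm, h, factorial_mul_pi_strictMono, mul_one]

end LinearExtensions

section Fubini

variable {α : Type*} [MeasurableSpace α] (μ : Measure α) [SigmaFinite μ]

theorem pi_setOf_lt_and_lt {A B C : Type*} [Fintype A] [Fintype B] [Fintype C] [LinearOrder α]
    [TopologicalSpace α] [OrderClosedTopology α] [SecondCountableTopology α]
    [OpensMeasurableSpace α] {u : A → (B → α) → α} {v : C → (B → α) → α}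
    (hu : ∀ a, Measurable (u a)) (hv : ∀ c, Measurable (v c)) :
    Measure.pi (fun _ : B ⊕ (A ⊕ C) => μ)
        {x | (∀ a, x (.inr (.inl a)) < u a fun b => x (.inl b)) ∧
          ∀ c, (v c fun b => x (.inl b)) < x (.inr (.inr c))} =
      ∫⁻ b, (∏ a, μ (Set.Iio (u a b))) * ∏ c, μ (Set.Ioi (v c b)) ∂Measure.pi fun _ => μ := by
  set S : Set ((B → α) × (A ⊕ C → α)) :=
    {p | (∀ a, p.2 (.inl a) < u a p.1) ∧ ∀ c, v c p.1 < p.2 (.inr c)} with hS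
  have hmeas : MeasurableSet S := by
    simp only [hS, Set.ofPred_and, Set.ofPred_forall]
    exact (MeasurableSet.iInter fun a => measurableSet_lt (by fun_prop) (by fun_prop)).inter
      (MeasurableSet.iInter fun c => measurableSet_lt (by fun_prop) (by fun_prop))
  have hslice (b : B → α) : Prod.mk b ⁻¹' S =
      Set.univ.pi (Sum.elim (fun a => Set.Iio (u a b)) fun c => Set.Ioi (v c b)) := by
    ext y
    simp [hS, Set.mem_pi]
  have hpre := (measurePreserving_sumPiEquivProdPi fun _ : B ⊕ (A ⊕ C) => μ).measure_preimage
    hmeas.nullMeasurableSet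
  rw [Measure.prod_apply hmeas] at hpre
  refine hpre.trans (lintegral_congr fun b => ?_)
  simp [hslice, Measure.pi_pi]

/-- The integral operator with kernel `k`, integrating over the first variable of `k`; its powers
evaluate integrals over paths with a weight for each step. -/
noncomputable def transferOp (k : α → α → ENNReal) (f : α → ENNReal) (y : α) : ENNReal :=
  ∫⁻ x, f x * k x y ∂μ

variable {μ} in
theorem measurable_transferOp {k : α → α → ENNReal} (hk : Measurable (Function.uncurry k))
    {f : α → ENNReal} (hf : Measurable f) : Measurable (transferOp μ k f) :=
  Measurable.lintegral_prod_left' (f := fun p : α × α => f p.1 * k p.1 p.2)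
    ((hf.comp measurable_fst).mul hk)

theorem lintegral_pi_chain {k : α → α → ENNReal} (hk : Measurable (Function.uncurry k))
    {g : α → ENNReal} (hg : Measurable g) (m : ℕ) {f : α → ENNReal} (hf : Measurable f) :
    ∫⁻ b : Fin (m + 1) → α, f (b 0) * (∏ i : Fin m, k (b i.castSucc) (b i.succ)) *
        g (b (Fin.last m)) ∂Measure.pi (fun _ => μ) =
      ∫⁻ x, (transferOp μ k)^[m] f x * g x ∂μ := by
  induction m generalizing f with
  | zero =>
    simp only [Finset.univ_eq_empty, Finset.prod_empty, mul_one]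
    convert (measurePreserving_funUnique μ (Fin 1)).lintegral_comp (hf.mul hg) <;> rfl
  | succ m ih =>
    have hk' {β : Type _} [MeasurableSpace β] {u v : β → α} (hu : Measurable u)
        (hv : Measurable v) : Measurable fun a => k (u a) (v a) := hk.comp (hu.prodMk hv)
    have hint : Measurable fun b : Fin (m + 2) → α =>
        f (b 0) * (∏ i : Fin (m + 1), k (b i.castSucc) (b i.succ)) * g (b (Fin.last (m + 1))) :=
      ((hf.comp (measurable_pi_apply _)).mul (Finset.measurable_prod _ fun i _ =>
        hk' (measurable_pi_apply _) (measurable_pi_apply _))).mul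
          (hg.comp (measurable_pi_apply _))
    rw [Function.iterate_succ_apply, ← ih (measurable_transferOp hk hf),
      ← (measurePreserving_piFinSuccAbove (fun _ : Fin (m + 2) => μ) 0).symm.lintegral_comp_emb
        (MeasurableEquiv.measurableEmbedding _),
      lintegral_prod_symm]
    swap
    · exact (hint.comp (MeasurableEquiv.measurable _)).aemeasurable
    refine lintegral_congr fun b => ?_
    have hfk : Measurable fun x => f x * k x (b 0) := hf.mul (hk' measurable_id measurable_const)
    rw [mul_assoc, transferOp, ← lintegral_mul_const _ hfk]
    refine lintegral_congr fun x => ?_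
    rw [Fin.prod_univ_succ]
    simp only [MeasurableEquiv.piFinSuccAbove_symm_apply, Fin.insertNthEquiv_zero,
      Fin.consEquiv_apply, Fin.castSucc_zero, Fin.cons_zero, Fin.cons_succ,
      ← Fin.succ_castSucc, ← Fin.succ_last]
    ring

end Fubini

section GreenOperator
open Polynomial

/-- The integral of a polynomial over the unit interval, as a linear functional. -/
noncomputable def unitIntegral : ℝ[X] →ₗ[ℝ] ℝ where
  toFun p := ∫ x in (0 : ℝ)..1, p.eval x
  map_add' p q := by
    simp only [eval_add]
    exact intervalIntegral.integral_add (p.continuous.intervalIntegrable _ _)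
      (q.continuous.intervalIntegrable _ _)
  map_smul' a p := by simp

/-- The Green operator `p ↦ q` of `-q'' = p`, `q 0 = q 1 = 0`, on polynomials. -/
noncomputable def greenOp : ℝ[X] →ₗ[ℝ] ℝ[X] :=
  lsum fun k => LinearMap.toSpanSingleton ℝ ℝ[X] ((((k : ℝ) + 1) * (k + 2))⁻¹ • (X - X ^ (k + 2)))

theorem linearMap_congr_of_X_pow {R M : Type*} [CommSemiring R] [AddCommMonoid M] [Module R M]
    {f g : R[X] →ₗ[R] M} (h : ∀ n, f (X ^ n) = g (X ^ n)) (p : R[X]) : f p = g p := by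
  refine LinearMap.congr_fun (lhom_ext' fun n => LinearMap.ext_ring ?_) p
  simpa only [LinearMap.comp_apply, X_pow_eq_monomial] using h n

theorem unitIntegral_X_pow (k : ℕ) : unitIntegral (X ^ k) = ((k : ℝ) + 1)⁻¹ := by
  simp [unitIntegral]

theorem unitIntegral_derivative (p : ℝ[X]) :
    unitIntegral (derivative p) = p.eval 1 - p.eval 0 :=
  intervalIntegral.integral_eq_sub_of_hasDerivAt (fun x _ => p.hasDerivAt x)
    (p.derivative.continuous.intervalIntegrable _ _)

theorem unitIntegral_X_mul_derivative_mul (p q : ℝ[X]) :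
    unitIntegral (X * derivative p * q) = p.eval 1 * q.eval 1 - unitIntegral (p * q) -
      unitIntegral (p * (X * derivative q)) := by
  have h := unitIntegral_derivative (X * p * q)
  have hprod : derivative (X * p * q) = p * q + X * derivative p * q + p * (X * derivative q) := by
    simp only [derivative_mul, derivative_X]
    ring
  simp only [hprod, map_add, eval_mul, eval_X] at h
  linear_combination h

theorem greenOp_X_pow (k : ℕ) :
    greenOp (X ^ k) = (((k : ℝ) + 1) * (k + 2))⁻¹ • (X - X ^ (k + 2)) := by
  rw [greenOp, lsum_apply, X_pow_eq_monomial, sum_monomial_index _ _ (by simp)]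
  simp

theorem eval_one_greenOp (p : ℝ[X]) : (greenOp p).eval 1 = 0 :=
  linearMap_congr_of_X_pow (f := leval 1 ∘ₗ greenOp) (g := 0)
    (fun n => by simp [greenOp_X_pow, leval]) p

theorem unitIntegral_greenOp_X_pow_mul_X_pow (j k : ℕ) :
    unitIntegral (greenOp (X ^ j) * X ^ k) = (((j : ℝ) + 2) * (k + 2) * (j + k + 3))⁻¹ := by
  rw [greenOp_X_pow, smul_mul_assoc, sub_mul, ← pow_succ', ← pow_add, map_smul, map_sub,
    unitIntegral_X_pow, unitIntegral_X_pow]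
  have h₁ : (j : ℝ) + 2 + k + 1 ≠ 0 := by positivity
  have h₂ : (k : ℝ) + 1 + 1 ≠ 0 := by positivity
  push_cast
  rw [smul_eq_mul]
  field_simp
  ring

theorem unitIntegral_greenOp_mul_comm (p q : ℝ[X]) :
    unitIntegral (greenOp p * q) = unitIntegral (p * greenOp q) := by
  let B : ℝ[X] →ₗ[ℝ] ℝ[X] →ₗ[ℝ] ℝ := (LinearMap.mul ℝ ℝ[X]).compr₂ unitIntegral
  refine linearMap_congr_of_X_pow (f := B (greenOp p)) (g := B p ∘ₗ greenOp) (fun k => ?_) q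
  refine linearMap_congr_of_X_pow (f := B.flip (X ^ k) ∘ₗ greenOp) (g := B.flip (greenOp (X ^ k)))
    (fun j => ?_) p
  change unitIntegral (greenOp (X ^ j) * X ^ k) = unitIntegral (X ^ j * greenOp (X ^ k))
  rw [mul_comm (X ^ j), unitIntegral_greenOp_X_pow_mul_X_pow, unitIntegral_greenOp_X_pow_mul_X_pow]
  ring

theorem unitIntegral_iterate_greenOp_mul_comm (m : ℕ) (p q : ℝ[X]) :
    unitIntegral (greenOp^[m] p * q) = unitIntegral (p * greenOp^[m] q) := by
  induction m generalizing p with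
  | zero => rfl
  | succ m ih =>
    rw [Function.iterate_succ_apply, ih, unitIntegral_greenOp_mul_comm,
      Function.iterate_succ_apply']

theorem X_mul_derivative_X_pow (n : ℕ) : X * derivative (X ^ n : ℝ[X]) = (n : ℝ) • X ^ n := by
  cases n with
  | zero => simp
  | succ n =>
    rw [derivative_X_pow, mul_left_comm, add_tsub_cancel_right, ← pow_succ', smul_eq_C_mul]

theorem X_mul_derivative_greenOp (p : ℝ[X]) :
    X * derivative (greenOp p) =
      greenOp (X * derivative p) + (2 : ℝ) • greenOp p - unitIntegral (X * p) • X := by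
  let E : ℝ[X] →ₗ[ℝ] ℝ[X] := LinearMap.mulLeft ℝ X ∘ₗ derivative
  refine linearMap_congr_of_X_pow (f := E ∘ₗ greenOp)
    (g := greenOp ∘ₗ E + (2 : ℝ) • greenOp -
      (unitIntegral ∘ₗ LinearMap.mulLeft ℝ X).smulRight X) (fun k => ?_) p
  have hE (n : ℕ) : E (X ^ n) = (n : ℝ) • X ^ n :=
    X_mul_derivative_X_pow n
  have hEX : E X = X := by simpa using hE 1
  have hcoeff : ((k : ℝ) + 1 + 1)⁻¹ = (k + 1) * (((k : ℝ) + 1) * (k + 2))⁻¹ := by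
    field_simp
    ring
  simp only [LinearMap.comp_apply, LinearMap.add_apply, LinearMap.sub_apply, LinearMap.smul_apply,
    LinearMap.smulRight_apply, LinearMap.mulLeft_apply, hE, map_smul, map_sub, greenOp_X_pow, hEX,
    ← pow_succ', unitIntegral_X_pow, Nat.cast_add, Nat.cast_one, Nat.cast_ofNat, hcoeff]
  module

open Finset in
theorem X_mul_derivative_iterate_greenOp (m : ℕ) (p : ℝ[X]) :
    X * derivative (greenOp^[m + 1] p) =
      greenOp^[m + 1] (X * derivative p) + (2 * (m + 1) : ℝ) • greenOp^[m + 1] p -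
        ∑ a ∈ antidiagonal m, unitIntegral (X * greenOp^[a.1] p) • greenOp^[a.2] X := by
  induction m with
  | zero => simp [X_mul_derivative_greenOp]
  | succ m ih =>
    rw [Function.iterate_succ_apply', X_mul_derivative_greenOp, ih, map_sub, map_add, map_smul,
      map_sum, ← Function.iterate_succ_apply' greenOp, ← Function.iterate_succ_apply' greenOp,
      Finset.Nat.sum_antidiagonal_succ']
    simp only [map_smul, ← Function.iterate_succ_apply', Function.iterate_zero_apply]
    push_cast
    module

/-- The bilinear pairing `⟨X ^ c, greenOp ^ m X ^ r⟩` in `L²(0, 1)`. -/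
noncomputable def greenMoment (r c m : ℕ) : ℝ :=
  unitIntegral (greenOp^[m] (X ^ r) * X ^ c)

theorem greenMoment_comm (r c m : ℕ) : greenMoment r c m = greenMoment c r m := by
  rw [greenMoment, unitIntegral_iterate_greenOp_mul_comm, mul_comm, greenMoment]

open Finset in
theorem greenMoment_recurrence (r c m : ℕ) :
    (2 * m + 3 + r + c) * greenMoment r c (m + 1) =
      ∑ a ∈ antidiagonal m, greenMoment r 1 a.1 * greenMoment 1 c a.2 := by
  have hone : (greenOp^[m + 1] (X ^ r)).eval 1 = 0 := by
    rw [Function.iterate_succ_apply', eval_one_greenOp]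
  have hparts := unitIntegral_X_mul_derivative_mul (greenOp^[m + 1] (X ^ r)) (X ^ c)
  have hiter : greenOp^[m + 1] ((r : ℝ) • X ^ r) = (r : ℝ) • greenOp^[m + 1] (X ^ r) := by
    simp only [← Module.End.coe_pow, map_smul]
  rw [X_mul_derivative_iterate_greenOp, hone, X_mul_derivative_X_pow,
    X_mul_derivative_X_pow, hiter, sub_mul, add_mul, sum_mul, map_sub, map_add, map_sum] at hparts
  simp only [smul_mul_assoc, mul_smul_comm, map_smul, smul_eq_mul, zero_mul] at hparts
  have hsum : ∑ a ∈ antidiagonal m, greenMoment r 1 a.1 * greenMoment 1 c a.2 =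
      ∑ a ∈ antidiagonal m, unitIntegral (X * greenOp^[a.1] (X ^ r)) *
        unitIntegral (greenOp^[a.2] X * X ^ c) := by
    simp only [greenMoment, pow_one, mul_comm X]
  rw [hsum, greenMoment]
  linear_combination hparts

end GreenOperator

section UnitInterval

open Polynomial

/-- The Green function of `-d²/dx²` on `[0, 1]` with Dirichlet boundary conditions. -/
def greenKernel (x y : ℝ) : ℝ := min x y * (1 - max x y)

@[fun_prop]
theorem continuous_greenKernel : Continuous (Function.uncurry greenKernel) := by
  unfold greenKernel Function.uncurry
  fun_prop

theorem greenKernel_nonneg (x y : unitInterval) : 0 ≤ greenKernel x y :=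
  mul_nonneg (le_min x.2.1 y.2.1) (sub_nonneg.2 (max_le x.2.2 y.2.2))

theorem integral_pow_mul_greenKernel (n : ℕ) (x : unitInterval) :
    ∫ y in (0 : ℝ)..1, y ^ n * greenKernel y x = (greenOp (X ^ n)).eval (x : ℝ) := by
  have hcont : Continuous fun y : ℝ => y ^ n * greenKernel y x := by fun_prop
  have hleft : ∫ y in (0 : ℝ)..x, y ^ n * greenKernel y x =
      ∫ y in (0 : ℝ)..x, (1 - x) * y ^ (n + 1) :=
    intervalIntegral.integral_congr fun y hy => by
      rw [Set.uIcc_of_le x.2.1] at hy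
      simp only [greenKernel, min_eq_left hy.2, max_eq_right hy.2]
      ring
  have hright : ∫ y in (x : ℝ)..1, y ^ n * greenKernel y x =
      ∫ y in (x : ℝ)..1, (x * y ^ n - x * y ^ (n + 1)) :=
    intervalIntegral.integral_congr fun y hy => by
      rw [Set.uIcc_of_le x.2.2] at hy
      simp only [greenKernel, min_eq_right hy.1, max_eq_left hy.1]
      ring
  rw [← intervalIntegral.integral_add_adjacent_intervals (hcont.intervalIntegrable 0 x)
    (hcont.intervalIntegrable x 1), hleft, hright, intervalIntegral.integral_sub
    (Continuous.intervalIntegrable (by fun_prop) _ _)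
    (Continuous.intervalIntegrable (by fun_prop) _ _), greenOp_X_pow]
  simp only [intervalIntegral.integral_const_mul, integral_pow, eval_smul, eval_sub, eval_pow,
    eval_X, smul_eq_mul]
  have h : (n : ℝ) + 1 + 1 ≠ 0 := by positivity
  push_cast
  field_simp
  ring

theorem integral_eval_mul_greenKernel (p : ℝ[X]) (x : unitInterval) :
    ∫ y in (0 : ℝ)..1, p.eval y * greenKernel y x = (greenOp p).eval (x : ℝ) := by
  induction p using Polynomial.induction_on' with
  | add p q hp hq =>
    simp only [eval_add, map_add, add_mul]
    rw [intervalIntegral.integral_add (Continuous.intervalIntegrable (by fun_prop) _ _)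
      (Continuous.intervalIntegrable (by fun_prop) _ _), hp, hq]
  | monomial n a =>
    rw [← C_mul_X_pow_eq_monomial, ← smul_eq_C_mul, map_smul, eval_smul,
      ← integral_pow_mul_greenKernel]
    simp [mul_assoc]

theorem lintegral_unitInterval_ofReal {f : ℝ → ℝ} (hf : Continuous f)
    (hf₀ : ∀ x : unitInterval, 0 ≤ f x) :
    ∫⁻ x : unitInterval, ENNReal.ofReal (f x) = ENNReal.ofReal (∫ x in (0 : ℝ)..1, f x) := by
  rw [intervalIntegral.integral_of_le zero_le_one, ← integral_Icc_eq_integral_Ioc,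
    ofReal_integral_eq_lintegral_ofReal hf.integrableOn_Icc
      ((ae_restrict_iff' measurableSet_Icc).2 (.of_forall fun x hx => hf₀ ⟨x, hx⟩))]
  exact lintegral_subtype_comap measurableSet_Icc fun x => ENNReal.ofReal (f x)

theorem greenOp_eval_nonneg {p : ℝ[X]} (hp : ∀ x : unitInterval, 0 ≤ p.eval (x : ℝ))
    (x : unitInterval) : 0 ≤ (greenOp p).eval (x : ℝ) := by
  rw [← integral_eval_mul_greenKernel]
  exact intervalIntegral.integral_nonneg zero_le_one fun y hy =>
    mul_nonneg (hp ⟨y, hy⟩) (greenKernel_nonneg ⟨y, hy⟩ x)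

theorem transferOp_greenKernel {p : ℝ[X]} (hp : ∀ x : unitInterval, 0 ≤ p.eval (x : ℝ)) :
    transferOp volume (fun x y : unitInterval => ENNReal.ofReal (greenKernel x y))
      (fun x => ENNReal.ofReal (p.eval (x : ℝ))) =
        fun x : unitInterval => ENNReal.ofReal ((greenOp p).eval (x : ℝ)) := by
  funext y
  simp only [transferOp, ← ENNReal.ofReal_mul (hp _)]
  rw [lintegral_unitInterval_ofReal (f := fun x => p.eval x * greenKernel x y) (by fun_prop)
    fun x => mul_nonneg (hp x) (greenKernel_nonneg x y), integral_eval_mul_greenKernel]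

theorem iterate_greenOp_X_pow_eval_nonneg (m r : ℕ) (x : unitInterval) :
    0 ≤ (greenOp^[m] (X ^ r)).eval (x : ℝ) := by
  induction m generalizing x with
  | zero => simpa using pow_nonneg x.2.1 r
  | succ m ih =>
    rw [Function.iterate_succ_apply']
    exact greenOp_eval_nonneg ih x

theorem iterate_transferOp_greenKernel (m r : ℕ) :
    (transferOp volume fun x y : unitInterval => ENNReal.ofReal (greenKernel x y))^[m]
      (fun x => ENNReal.ofReal x ^ r) =
        fun x : unitInterval => ENNReal.ofReal ((greenOp^[m] (X ^ r)).eval (x : ℝ)) := by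
  induction m with
  | zero =>
    funext x
    simp [ENNReal.ofReal_pow x.2.1]
  | succ m ih =>
    rw [Function.iterate_succ_apply', ih, Function.iterate_succ_apply',
      transferOp_greenKernel (iterate_greenOp_X_pow_eval_nonneg m r)]

theorem iterate_greenOp_X_pow_mul_X_pow_eval_nonneg (m r c : ℕ) (x : unitInterval) :
    0 ≤ (greenOp^[m] (X ^ r) * X ^ c).eval (x : ℝ) := by
  rw [eval_mul, eval_pow, eval_X]
  exact mul_nonneg (iterate_greenOp_X_pow_eval_nonneg m r x) (pow_nonneg x.2.1 c)

theorem greenMoment_nonneg (r c m : ℕ) : 0 ≤ greenMoment r c m :=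
  intervalIntegral.integral_nonneg zero_le_one fun x hx =>
    iterate_greenOp_X_pow_mul_X_pow_eval_nonneg m r c ⟨x, hx⟩

theorem lintegral_greenKernel_chain (r c m : ℕ) :
    ∫⁻ b : Fin (m + 1) → unitInterval, ENNReal.ofReal (b 0) ^ r *
        (∏ i : Fin m, ENNReal.ofReal (greenKernel (b i.castSucc) (b i.succ))) *
        ENNReal.ofReal (b (Fin.last m)) ^ c =
      ENNReal.ofReal (greenMoment r c m) := by
  have hpow (k : ℕ) : Measurable fun x : unitInterval => ENNReal.ofReal x ^ k := by fun_prop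
  have hker : Measurable (Function.uncurry fun x y : unitInterval =>
      ENNReal.ofReal (greenKernel x y)) := by
    unfold Function.uncurry
    fun_prop
  rw [volume_pi, lintegral_pi_chain volume hker (hpow c) m (hpow r),
    iterate_transferOp_greenKernel]
  have hmul (x : unitInterval) :
      ENNReal.ofReal ((greenOp^[m] (X ^ r)).eval (x : ℝ)) * ENNReal.ofReal x ^ c =
        ENNReal.ofReal ((greenOp^[m] (X ^ r) * X ^ c).eval (x : ℝ)) := by
    rw [eval_mul, eval_pow, eval_X, ENNReal.ofReal_mul (iterate_greenOp_X_pow_eval_nonneg m r x),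
      ENNReal.ofReal_pow x.2.1]
  simp only [hmul]
  exact lintegral_unitInterval_ofReal (Polynomial.continuous _)
    (iterate_greenOp_X_pow_mul_X_pow_eval_nonneg m r c)

end UnitInterval

section Tableaux

theorem SkewShape.mem_cells {S : SkewShape} {p : ℕ × ℕ} :
    p ∈ S.cells ↔ p ∈ S.outer ∧ p ∉ S.inner := by
  simp [SkewShape.cells]

theorem SkewShape.ordConnected_cells (S : SkewShape) :
    (S.cells : Set (ℕ × ℕ)).OrdConnected := by
  refine ⟨fun p hp q hq x hx => ?_⟩
  rw [Finset.mem_coe, SkewShape.mem_cells] at hp hq ⊢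
  exact ⟨S.outer.isLowerSet hx.2 hq.1, fun h => hp.2 (S.inner.isLowerSet hx.1 h)⟩

theorem covBy_nat_prod_iff {p q : ℕ × ℕ} :
    p ⋖ q ↔ (p.1 = q.1 ∧ p.2 + 1 = q.2) ∨ (p.2 = q.2 ∧ p.1 + 1 = q.1) := by
  rw [Prod.covBy_iff, Nat.covBy_iff_add_one_eq, Nat.covBy_iff_add_one_eq]
  tauto

theorem strictMono_cells_iff {S : SkewShape} {β : Type*} [Preorder β] {f : S.cells → β} :
    StrictMono f ↔ ∀ p q : S.cells, p.1 ⋖ q.1 → f p < f q := by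
  have hcov (p q : S.cells) : p ⋖ q ↔ p.1 ⋖ q.1 :=
    (Set.OrdConnected.apply_covBy_apply_iff (OrderEmbedding.subtype (· ∈ S.cells))
      (by simpa using S.ordConnected_cells)).symm
  simp only [strictMono_iff_forall_covBy, hcov]

theorem numTableaux_eq_card {ι : Type*} (S : SkewShape) (φ : ι ≃ S.cells) :
    numTableaux S = Nat.card {e : ι ≃ Finset.Icc 1 S.cells.card //
      ∀ i j, (φ i).1 ⋖ (φ j).1 → e i < e j} := by
  have hmono (e : {e : ι ≃ Finset.Icc 1 S.cells.card // ∀ i j, (φ i).1 ⋖ (φ j).1 → e i < e j}) :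
      StrictMono (φ.symm.trans e.1) :=
    strictMono_cells_iff.2 fun p q hpq => e.2 _ _ (by simpa using hpq)
  refine Nat.card_congr
    { toFun := fun t => ⟨φ.trans t.entry, fun i j hij => ?_⟩
      invFun := fun e => ⟨φ.symm.trans e.1, fun p q h h' => hmono e (Prod.lt_of_le_of_lt h.le h'),
        fun p q h h' => hmono e (Prod.lt_of_lt_of_le h' h.le)⟩
      left_inv := fun t => entry_injective S (by ext; simp)
      right_inv := fun e => Subtype.ext (by ext; simp) }
  rcases covBy_nat_prod_iff.1 hij with ⟨h, h'⟩ | ⟨h, h'⟩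
  · exact t.row_lt _ _ h (by omega)
  · exact t.col_lt _ _ h (by omega)

end Tableaux

section Strips

/-- Indices for the boxes of a strip of three antidiagonals: the middle one, the lower one (the
boxes next to two middle ones, then `r` at its top right and `c` at its bottom left end, each next
to only one), and the upper one. -/
abbrev StripIndex (r c m : ℕ) : Type := Fin (m + 1) ⊕ ((Fin m ⊕ (Fin r ⊕ Fin c)) ⊕ Fin m)

/-- The box `(row, column)` of a strip with a given index. This is the intended box only for
`r, c ≤ 1`, the number of end boxes in our shapes. -/
def stripBox (r c m : ℕ) : StripIndex r c m → ℕ × ℕ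
  | .inl i => (r + i, m - i + c)
  | .inr (.inl (.inl i)) => (r + i, m - 1 - i + c)
  | .inr (.inl (.inr (.inl e))) => (e, m + c)
  | .inr (.inl (.inr (.inr e))) => (r + m, e)
  | .inr (.inr i) => (r + i + 1, m - i + c)

/-- `S` consists of the boxes of an `(m + r + 1) × (m + c + 1)` rectangle on the antidiagonal
`i + j = m + r + c` and the two adjacent ones. -/
def IsStrip (S : SkewShape) (r c m : ℕ) : Prop :=
  ∀ p : ℕ × ℕ, p ∈ S.cells ↔ p.1 ≤ m + r ∧ p.2 ≤ m + c ∧ m + r + c ≤ p.1 + p.2 + 1 ∧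
    p.1 + p.2 + 1 ≤ m + r + c + 2

variable {S : SkewShape} {r c m : ℕ}

theorem stripBox_mem (hr : r ≤ 1) (hc : c ≤ 1) (hS : IsStrip S r c m) (i : StripIndex r c m) :
    stripBox r c m i ∈ S.cells := by
  rw [hS]
  rcases i with i | (i | (i | i)) | i <;> simp only [stripBox] <;> omega

theorem stripBox_injective (hr : r ≤ 1) (hc : c ≤ 1) : Function.Injective (stripBox r c m) := by
  intro i j h
  rcases i with i | (i | (i | i)) | i <;> rcases j with j | (j | (j | j)) | j <;>
    simp only [stripBox, Prod.mk.injEq] at h <;>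
    first
    | (exfalso; omega)
    | (simp only [Sum.inl.injEq, Sum.inr.injEq]; omega)

theorem exists_stripBox_eq (hS : IsStrip S r c m) {p : ℕ × ℕ} (hp : p ∈ S.cells) :
    ∃ i, stripBox r c m i = p := by
  obtain ⟨x, y⟩ := p
  rw [hS] at hp
  simp only at hp
  obtain hlow | hmid | hupp : x + y + 1 = m + r + c ∨ x + y = m + r + c ∨
      x + y = m + r + c + 1 := by omega
  · by_cases hx : x < r
    · exact ⟨.inr (.inl (.inr (.inl ⟨x, hx⟩))), Prod.ext rfl (by simp only [stripBox]; omega)⟩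
    · by_cases hy : y < c
      · exact ⟨.inr (.inl (.inr (.inr ⟨y, hy⟩))), Prod.ext (by simp only [stripBox]; omega) rfl⟩
      · exact ⟨.inr (.inl (.inl ⟨x - r, by omega⟩)), by simp only [stripBox, Prod.mk.injEq]; omega⟩
  · exact ⟨.inl ⟨x - r, by omega⟩, by simp only [stripBox, Prod.mk.injEq]; omega⟩
  · exact ⟨.inr (.inr ⟨x - r - 1, by omega⟩), by simp only [stripBox, Prod.mk.injEq]; omega⟩

/-- The enumeration of the boxes of the strip `S` by `StripIndex`. -/
noncomputable def stripEquiv (hr : r ≤ 1) (hc : c ≤ 1) (hS : IsStrip S r c m) :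
    StripIndex r c m ≃ S.cells :=
  Equiv.ofBijective (fun i => ⟨stripBox r c m i, stripBox_mem hr hc hS i⟩)
    ⟨fun _ _ h => stripBox_injective hr hc (congrArg Subtype.val h), fun p =>
      let ⟨i, hi⟩ := exists_stripBox_eq hS p.2
      ⟨i, Subtype.ext hi⟩⟩

/-- The first of the one or two middle boxes next to a lower box. -/
def lowerFst : Fin m ⊕ (Fin r ⊕ Fin c) → Fin (m + 1) :=
  Sum.elim Fin.castSucc (Sum.elim (fun _ => 0) fun _ => Fin.last m)

/-- The last of the one or two middle boxes next to a lower box. -/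
def lowerSnd : Fin m ⊕ (Fin r ⊕ Fin c) → Fin (m + 1) :=
  Sum.elim Fin.succ (Sum.elim (fun _ => 0) fun _ => Fin.last m)

theorem lower_covBy_middle_iff (hr : r ≤ 1) (hc : c ≤ 1) (a : Fin m ⊕ (Fin r ⊕ Fin c))
    (j : Fin (m + 1)) :
    stripBox r c m (.inr (.inl a)) ⋖ stripBox r c m (.inl j) ↔
      j = lowerFst a ∨ j = lowerSnd a := by
  rcases a with i | i | i <;>
    simp only [covBy_nat_prod_iff, stripBox, lowerFst, lowerSnd, Sum.elim_inl, Sum.elim_inr,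
      Fin.ext_iff, Fin.val_castSucc, Fin.val_succ, Fin.val_zero, Fin.val_last] <;> omega

theorem middle_covBy_upper_iff (j : Fin (m + 1)) (i : Fin m) :
    stripBox r c m (.inl j) ⋖ stripBox r c m (.inr (.inr i)) ↔
      j = i.castSucc ∨ j = i.succ := by
  simp only [covBy_nat_prod_iff, stripBox, Fin.ext_iff, Fin.val_castSucc, Fin.val_succ]
  omega

theorem stripBox_covBy_cases (hr : r ≤ 1) (hc : c ≤ 1) {i j : StripIndex r c m}
    (h : stripBox r c m i ⋖ stripBox r c m j) :
    (∃ a b, i = .inr (.inl a) ∧ j = .inl b) ∨ ∃ b u, i = .inl b ∧ j = .inr (.inr u) := by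
  rw [covBy_nat_prod_iff] at h
  rcases i with i | (i | (i | i)) | i <;> rcases j with j | (j | (j | j)) | j <;>
    simp only [stripBox] at h <;>
    first
    | (exfalso; omega)
    | simp

theorem forall_stripBox_covBy_iff {α : Type*} [LinearOrder α] (hr : r ≤ 1) (hc : c ≤ 1)
    (x : StripIndex r c m → α) :
    (∀ i j, stripBox r c m i ⋖ stripBox r c m j → x i < x j) ↔
      (∀ a, x (.inr (.inl a)) < min (x (.inl (lowerFst a))) (x (.inl (lowerSnd a)))) ∧
        ∀ i : Fin m, max (x (.inl i.castSucc)) (x (.inl i.succ)) < x (.inr (.inr i)) := by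
  simp only [lt_min_iff, max_lt_iff]
  constructor
  · refine fun h => ⟨fun a => ⟨h _ _ ?_, h _ _ ?_⟩, fun i => ⟨h _ _ ?_, h _ _ ?_⟩⟩ <;>
      simp [lower_covBy_middle_iff hr hc, middle_covBy_upper_iff]
  · rintro ⟨hlower, hupper⟩ i j h
    rcases stripBox_covBy_cases hr hc h with ⟨a, b, rfl, rfl⟩ | ⟨b, u, rfl, rfl⟩
    · rcases (lower_covBy_middle_iff hr hc a b).1 h with rfl | rfl
      exacts [(hlower a).1, (hlower a).2]
    · rcases (middle_covBy_upper_iff b u).1 h with rfl | rfl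
      exacts [(hupper u).1, (hupper u).2]

theorem volume_strip_eq_greenMoment (r c m : ℕ) :
    volume {x : StripIndex r c m → unitInterval |
        (∀ a, x (.inr (.inl a)) < min (x (.inl (lowerFst a))) (x (.inl (lowerSnd a)))) ∧
          ∀ i : Fin m, max (x (.inl i.castSucc)) (x (.inl i.succ)) < x (.inr (.inr i))} =
      ENNReal.ofReal (greenMoment r c m) := by
  have hmin (x y : unitInterval) : ((min x y : unitInterval) : ℝ) = min (x : ℝ) y :=
    Subtype.mono_coe _ |>.map_min
  have hmax (x y : unitInterval) : ((max x y : unitInterval) : ℝ) = max (x : ℝ) y :=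
    Subtype.mono_coe _ |>.map_max
  have hker (x y : unitInterval) : ENNReal.ofReal (greenKernel x y) =
      volume (Set.Iio (min x y)) * volume (Set.Ioi (max x y)) := by
    rw [unitInterval.volume_Iio, unitInterval.volume_Ioi, hmin, hmax, greenKernel,
      ENNReal.ofReal_mul (le_min x.2.1 y.2.1)]
  refine (pi_setOf_lt_and_lt volume
    (u := fun a (b : Fin (m + 1) → unitInterval) => min (b (lowerFst a)) (b (lowerSnd a)))
    (v := fun (i : Fin m) b => max (b i.castSucc) (b i.succ))
    (by fun_prop) (by fun_prop)).trans ?_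
  rw [← lintegral_greenKernel_chain, volume_pi]
  refine lintegral_congr fun b => ?_
  simp only [Fintype.prod_sum_type, lowerFst, lowerSnd, Sum.elim_inl, Sum.elim_inr, min_self,
    Finset.prod_const, Finset.card_univ, Fintype.card_fin, hker, Finset.prod_mul_distrib,
    unitInterval.volume_Iio]
  ring

theorem card_stripIndex (r c m : ℕ) : Fintype.card (StripIndex r c m) = 3 * m + 1 + r + c := by
  simp only [StripIndex, Fintype.card_sum, Fintype.card_fin]
  ring

theorem numTableaux_eq_greenMoment (hr : r ≤ 1) (hc : c ≤ 1) (hS : IsStrip S r c m) :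
    (numTableaux S : ℝ) = (3 * m + 1 + r + c).factorial * greenMoment r c m := by
  have hcells : Fintype.card (StripIndex r c m) = Fintype.card (Finset.Icc 1 S.cells.card) := by
    simp [Fintype.card_congr (stripEquiv hr hc hS)]
  have h := card_linearExtensions (volume : Measure unitInterval) hcells
    fun i j => stripBox r c m i ⋖ stripBox r c m j
  simp only [forall_stripBox_covBy_iff (α := unitInterval) hr hc] at h
  rw [← volume_pi, volume_strip_eq_greenMoment, card_stripIndex] at h
  have hreal := congrArg ENNReal.toReal h
  rw [ENNReal.toReal_mul, ENNReal.toReal_ofReal (greenMoment_nonneg r c m),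
    ENNReal.toReal_natCast, ENNReal.toReal_natCast] at hreal
  rw [numTableaux_eq_card S (stripEquiv hr hc hS), ← hreal]
  rfl

open Finset in
theorem numTableaux_recurrence {T U : ℕ → SkewShape} (hr : r ≤ 1) (hc : c ≤ 1)
    (hS : IsStrip S r c (m + 1)) (hT : ∀ a, IsStrip (T a) 1 r a) (hU : ∀ b, IsStrip (U b) 1 c b) :
    (2 * m + 3 + r + c) * numTableaux S = ∑ a ∈ antidiagonal m,
      (3 * m + 4 + r + c).choose (3 * a.1 + 2 + r) * numTableaux (T a.1) *
        numTableaux (U a.2) := by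
  have hterm (a : ℕ × ℕ) (ha : a ∈ antidiagonal m) :
      ((3 * m + 4 + r + c).choose (3 * a.1 + 2 + r) * numTableaux (T a.1) *
        numTableaux (U a.2) : ℝ) =
      (3 * m + 4 + r + c).factorial * (greenMoment r 1 a.1 * greenMoment 1 c a.2) := by
    have hsum : 3 * m + 4 + r + c = (3 * a.1 + 2 + r) + (3 * a.2 + 2 + c) := by
      have := mem_antidiagonal.1 ha
      omega
    rw [numTableaux_eq_greenMoment le_rfl hr (hT a.1),
      numTableaux_eq_greenMoment le_rfl hc (hU a.2), greenMoment_comm 1 r, hsum,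
      Nat.choose_symm_add, ← Nat.add_choose_mul_factorial_mul_factorial (3 * a.1 + 2 + r)]
    push_cast
    ring
  have hS' := numTableaux_eq_greenMoment hr hc hS
  rw [show 3 * (m + 1) + 1 + r + c = 3 * m + 4 + r + c by ring] at hS'
  have hrec := greenMoment_recurrence r c m
  rify
  rw [sum_congr rfl hterm, ← mul_sum, ← hrec, hS']
  ring

end Strips

section Shapes

theorem isStrip_sigmaSubTwo (m : ℕ) : IsStrip (sigmaSubTwo (m + 1)) 0 0 m := by
  rintro ⟨x, y⟩
  rw [SkewShape.mem_cells, sigmaSubTwo, YoungDiagram.mem_ofRowLens, YoungDiagram.mem_ofRowLens]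
  rcases x with _ | x <;>
  · simp only [List.length_cons, length_descending, List.getElem_cons_zero,
      List.getElem_cons_succ, getElem_descending, exists_prop]
    omega

theorem isStrip_sigmaSubOne (m : ℕ) : IsStrip (sigmaSubOne (m + 1)) 1 0 m := by
  rintro ⟨x, y⟩
  rw [SkewShape.mem_cells, sigmaSubOne, YoungDiagram.mem_ofRowLens, YoungDiagram.mem_ofRowLens]
  rcases x with _ | _ | x <;>
  · simp only [List.length_cons, length_descending, List.getElem_cons_zero,
      List.getElem_cons_succ, getElem_descending, exists_prop]
    omega

theorem isStrip_tauShape (m : ℕ) : IsStrip (tauShape (m + 1)) 1 1 m := by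
  rintro ⟨x, y⟩
  rw [SkewShape.mem_cells, tauShape, YoungDiagram.mem_ofRowLens, YoungDiagram.mem_ofRowLens]
  rcases x with _ | _ | x <;>
  · simp only [List.length_cons, length_descending, List.getElem_cons_zero,
      List.getElem_cons_succ, getElem_descending, exists_prop]
    omega

open Finset in
theorem sum_Icc_one_eq_sum_antidiagonal {M : Type*} [AddCommMonoid M] (f : ℕ → ℕ → M) (m : ℕ) :
    ∑ i ∈ Icc 1 (m + 1), f i (m + 2 - i) = ∑ a ∈ antidiagonal m, f (a.1 + 1) (a.2 + 1) := by
  rw [Nat.sum_antidiagonal_eq_sum_range_succ fun i j => f (i + 1) (j + 1), range_eq_Ico,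
    ← Ico_add_one_right_eq_Icc, ← sum_Ico_add' (fun i => f i (m + 2 - i)) 0 (m + 1) 1]
  refine sum_congr rfl fun i hi => ?_
  rw [show m + 2 - (i + 1) = m - i + 1 by have := (mem_Ico.1 hi).2; omega]

open Finset in
theorem numTableaux_sigmaSubTwo_recurrence (m : ℕ) :
    (2 * m + 3) * numTableaux (sigmaSubTwo (m + 2)) = ∑ i ∈ Icc 1 (m + 1),
      (3 * (m + 2) - 2).choose (3 * i - 1) * numTableaux (sigmaSubOne i) *
        numTableaux (sigmaSubOne (m + 2 - i)) := by
  have h := numTableaux_recurrence (T := fun a => sigmaSubOne (a + 1))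
    (U := fun a => sigmaSubOne (a + 1)) zero_le_one zero_le_one (isStrip_sigmaSubTwo (m + 1))
    isStrip_sigmaSubOne isStrip_sigmaSubOne
  rw [sum_Icc_one_eq_sum_antidiagonal fun i j => (3 * (m + 2) - 2).choose (3 * i - 1) *
    numTableaux (sigmaSubOne i) * numTableaux (sigmaSubOne j)]
  simpa [Nat.mul_add] using h

open Finset in
theorem numTableaux_tauShape_recurrence (m : ℕ) :
    (2 * m + 5) * numTableaux (tauShape (m + 2)) = ∑ i ∈ Icc 1 (m + 1),
      (3 * (m + 2)).choose (3 * i) * numTableaux (tauShape i) *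
        numTableaux (tauShape (m + 2 - i)) := by
  have h := numTableaux_recurrence (T := fun a => tauShape (a + 1))
    (U := fun a => tauShape (a + 1)) le_rfl le_rfl (isStrip_tauShape (m + 1))
    isStrip_tauShape isStrip_tauShape
  rw [sum_Icc_one_eq_sum_antidiagonal fun i j => (3 * (m + 2)).choose (3 * i) *
    numTableaux (tauShape i) * numTableaux (tauShape j)]
  simpa [Nat.mul_add, add_assoc] using h

end Shapes

theorem theorem2 (n : ℕ) (hn : 2 ≤ n) :
    (numTableaux (sigmaSubTwo n) : ℚ) =
        1 / (2 * (n : ℚ) - 1) *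
          ∑ i ∈ Finset.Icc 1 (n - 1),
            (Nat.choose (3 * n - 2) (3 * i - 1) : ℚ) *
              (numTableaux (sigmaSubOne i) : ℚ) * (numTableaux (sigmaSubOne (n - i)) : ℚ) ∧
      (numTableaux (tauShape n) : ℚ) =
        1 / (2 * (n : ℚ) + 1) *
          ∑ i ∈ Finset.Icc 1 (n - 1),
            (Nat.choose (3 * n) (3 * i) : ℚ) *
              (numTableaux (tauShape i) : ℚ) * (numTableaux (tauShape (n - i)) : ℚ) := by
  obtain ⟨m, rfl⟩ := Nat.exists_eq_add_of_le' hn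
  have hσ := congrArg (Nat.cast (R := ℚ)) (numTableaux_sigmaSubTwo_recurrence m)
  have hτ := congrArg (Nat.cast (R := ℚ)) (numTableaux_tauShape_recurrence m)
  push_cast at hσ hτ ⊢
  have hpos : 2 * ((m : ℚ) + 2) - 1 ≠ 0 := by linarith
  exact ⟨by rw [← hσ]; field_simp; ring, by rw [← hτ]; field_simp; ring⟩
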